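/- Let $\bar x\in\mathbb{R}$, $\Omega=[0,\bar x]\times[0,\infty)$, and let $G=\{(x,y)\in\Omega: y=0\}$ be the goal line. An evader $E$ and two pursuers $P_1,P_2$ start at the points $(x_E,y_E)$, $(x_1,y_1)$, $(x_2,y_2)$ of $\Omega$, where $x_1<x_2$ and $E\neq P_1$, $E\neq P_2$, and move in $\Omega$ with the same constant speed $v>0$; the controls are the headings (measurable functions of time with values in $[-\pi,\pi]$), so that $\dot x=v\cos\phi$, $\dot y=v\sin\phi$ for each player. The evader is captured when a pursuer is at his position. The pursuers cooperate and use non-anticipative strategies; the evader uses non-anticipative strategies with an arbitrarily small positive reaction delay. The evader's winning set $\mathcal R_e$ consists of the states from which he has a strategy that, against every admissible control of the pursuers, brings him to $G$ before he is captured. The pursuers' winning set $\mathcal R_p$ consists of the states from which they have a strategy under which, for every admissible control of the evader, he does not touch $G$ before or at the moment of capture. The Barrier $\mathcal B$ consists of the states from which each side has a strategy that guarantees it at least a tie, a tie being capture at the moment when the evader arrives at $G$. Let $(x_I,0)$, with $x_I=\frac12\,\frac{x_2^2+y_2^2-x_1^2-y_1^2}{x_2-x_1}$, be the point where the perpendicular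 bisector of $P_1P_2$ meets the line $y=0$. Assume that this point lies on the goal line, $0\le x_I\le\bar x$ (it is enough that $0\le x_I$ if $x_E<x_2$ and that $x_I\le\bar x$ if $x_E>x_1$). Put $$B(\mathbf x)=\begin{cases} x_1^2+y_1^2-x_E^2-y_E^2, & x_E\le x_1,\\ (x_1-x_I)^2+y_1^2-(x_E-x_I)^2-y_E^2, & x_1<x_E<x_2,\\ (x_2-\bar x)^2+y_2^2-(x_E-\bar x)^2-y_E^2, & x_E\ge x_2.\end{cases}$$ Then $\mathbf x\in\mathcal R_p$ if and only if $B(\mathbf x)<0$, $\mathbf x\in\mathcal R_e$ if and only if $B(\mathbf x)>0$, and $\mathbf x\in\mathcal B$ if and only if $B(\mathbf x)=0$. -/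

import Mathlib

open MeasureTheory

noncomputable section

namespace Football

/-- The complete state: positions of the evader `E` and of the pursuers `P₁`, `P₂`. -/
structure State where
  xE : ℝ
  yE : ℝ
  x1 : ℝ
  y1 : ℝ
  x2 : ℝ
  y2 : ℝ

namespace State

/-- The position of the evader. -/
def E (x : State) : ℝ × ℝ := (x.xE, x.yE)

/-- The position of the first pursuer. -/
def P1 (x : State) : ℝ × ℝ := (x.x1, x.y1)

/-- The position of the second pursuer. -/
def P2 (x : State) : ℝ × ℝ := (x.x2, x.y2)

/-- The abscissa `x_I` of the intersection of the perpendicular bisector of `P₁P₂` with the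
`x`-axis. -/
def xI (x : State) : ℝ :=
  1 / 2 * ((x.x2 ^ 2 + x.y2 ^ 2 - x.x1 ^ 2 - x.y1 ^ 2) / (x.x2 - x.x1))

end State

/-- The segment of the Barrier function for `x_E ≤ x_1`. -/
def B1 (x : State) : ℝ := x.x1 ^ 2 + x.y1 ^ 2 - x.xE ^ 2 - x.yE ^ 2

/-- The segment of the Barrier function for `x_1 < x_E < x_2`. -/
def B2 (x : State) : ℝ :=
  (x.x1 - x.xI) ^ 2 + x.y1 ^ 2 - (x.xE - x.xI) ^ 2 - x.yE ^ 2

/-- The segment of the Barrier function for `x_2 ≤ x_E`. -/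
def B3 (xbar : ℝ) (x : State) : ℝ :=
  (x.x2 - xbar) ^ 2 + x.y2 ^ 2 - (x.xE - xbar) ^ 2 - x.yE ^ 2

open Classical in
/-- The Barrier function. -/
def B (xbar : ℝ) (x : State) : ℝ :=
  if x.xE ≤ x.x1 then B1 x else if x.xE < x.x2 then B2 x else B3 xbar x

/-- The playing field `Ω = [0, x̄] × [0, ∞)`. -/
def field (xbar : ℝ) : Set (ℝ × ℝ) := {p | 0 ≤ p.1 ∧ p.1 ≤ xbar ∧ 0 ≤ p.2}

/-- The goal line `G = {(x, y) ∈ Ω | y = 0}`. -/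
def goal (xbar : ℝ) : Set (ℝ × ℝ) := {p | p ∈ field xbar ∧ p.2 = 0}

/-- The position at time `t` of a player that starts at `p` and moves with speed `v` and heading
angle `φ`: the solution of `x' = v cos φ`, `y' = v sin φ`. -/
def pos (v : ℝ) (p : ℝ × ℝ) (φ : ℝ → ℝ) (t : ℝ) : ℝ × ℝ :=
  (p.1 + ∫ s in (0 : ℝ)..t, v * Real.cos (φ s), p.2 + ∫ s in (0 : ℝ)..t, v * Real.sin (φ s))

/-- The admissible controls of a player that starts at `p`: measurable headings in `[-π, π]` that
keep the player in the field. Only the times `t ≥ 0` matter. -/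
def Admissible (xbar v : ℝ) (p : ℝ × ℝ) (φ : ℝ → ℝ) : Prop :=
  Measurable φ ∧ (∀ t, φ t ∈ Set.Icc (-Real.pi) Real.pi) ∧
    ∀ t, 0 ≤ t → pos v p φ t ∈ field xbar

/-- An admissible pair of controls `(ψ₁, ψ₂)` of the pursuer team. -/
def TeamAdmissible (xbar v : ℝ) (x : State) (ψ : (ℝ → ℝ) × (ℝ → ℝ)) : Prop :=
  Admissible xbar v x.P1 ψ.1 ∧ Admissible xbar v x.P2 ψ.2

/-- Two controls agree up to time `t` (almost everywhere, as usual for controls). -/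
def AgreeUpTo (t : ℝ) (a b : ℝ → ℝ) : Prop :=
  ∀ᵐ s ∂(volume.restrict (Set.Icc 0 t)), a s = b s

/-- The team controls `ψ` and `ψ'` agree up to time `t`. -/
def TeamAgreeUpTo (t : ℝ) (ψ ψ' : (ℝ → ℝ) × (ℝ → ℝ)) : Prop :=
  AgreeUpTo t ψ.1 ψ'.1 ∧ AgreeUpTo t ψ.2 ψ'.2

/-- A non-anticipative strategy of the pursuer team: what the team does up to time `t` depends only
on what the evader has done up to time `t`. -/
def TeamStrategy (xbar v : ℝ) (x : State) (β : (ℝ → ℝ) → (ℝ → ℝ) × (ℝ → ℝ)) : Prop :=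
  (∀ φ, Admissible xbar v x.E φ → TeamAdmissible xbar v x (β φ)) ∧
    ∀ φ φ', Admissible xbar v x.E φ → Admissible xbar v x.E φ' →
      ∀ t, 0 ≤ t → AgreeUpTo t φ φ' → TeamAgreeUpTo t (β φ) (β φ')

/-- A non-anticipative strategy (with delay) of the evader: for some reaction time `τ > 0`, what
the evader does up to time `t + τ` depends only on what the pursuers have done up to time `t`. The
delay, which may be arbitrarily small, makes a pair of strategies of the two sides determine a
play. -/
def EvaderStrategy (xbar v : ℝ) (x : State) (α : (ℝ → ℝ) × (ℝ → ℝ) → (ℝ → ℝ)) : Prop :=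
  (∀ ψ, TeamAdmissible xbar v x ψ → Admissible xbar v x.E (α ψ)) ∧
    ∃ τ : ℝ, 0 < τ ∧ ∀ ψ ψ', TeamAdmissible xbar v x ψ → TeamAdmissible xbar v x ψ' →
      ∀ t, 0 ≤ t → TeamAgreeUpTo t ψ ψ' → AgreeUpTo (t + τ) (α ψ) (α ψ')

/-- With the control `φ`, the evader is on the goal line at time `t`. -/
def AtGoal (xbar v : ℝ) (x : State) (φ : ℝ → ℝ) (t : ℝ) : Prop :=
  pos v x.E φ t ∈ goal xbar

/-- In the play with controls `φ`, `ψ`, some pursuer is at the position of the evader at time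
`t` (point capture). -/
def CaptureAt (v : ℝ) (x : State) (φ : ℝ → ℝ) (ψ : (ℝ → ℝ) × (ℝ → ℝ)) (t : ℝ) : Prop :=
  pos v x.P1 ψ.1 t = pos v x.E φ t ∨ pos v x.P2 ψ.2 t = pos v x.E φ t

/-- The evader reaches the goal line before being captured. -/
def ReachesFirst (xbar v : ℝ) (x : State) (φ : ℝ → ℝ) (ψ : (ℝ → ℝ) × (ℝ → ℝ)) : Prop :=
  ∃ t, 0 ≤ t ∧ AtGoal xbar v x φ t ∧ ∀ s, 0 ≤ s → s ≤ t → ¬ CaptureAt v x φ ψ s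

/-- The evader reaches the goal line before being captured or at the moment of capture. -/
def ReachesFirstOrTie (xbar v : ℝ) (x : State) (φ : ℝ → ℝ) (ψ : (ℝ → ℝ) × (ℝ → ℝ)) : Prop :=
  ∃ t, 0 ≤ t ∧ AtGoal xbar v x φ t ∧ ∀ s, 0 ≤ s → s < t → ¬ CaptureAt v x φ ψ s

/-- The states from which the pursuer team has a strategy under which, whatever the evader does,
he does not touch the goal line before or at the moment of capture. -/
def pursuersWinningSet (xbar v : ℝ) : Set State :=
  {x | ∃ β, TeamStrategy xbar v x β ∧
    ∀ φ, Admissible xbar v x.E φ → ¬ ReachesFirstOrTie xbar v x φ (β φ)}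

/-- The states from which the evader has a strategy that, whatever the pursuers do, brings him to
the goal line before capture. -/
def evaderWinningSet (xbar v : ℝ) : Set State :=
  {x | ∃ α, EvaderStrategy xbar v x α ∧
    ∀ ψ, TeamAdmissible xbar v x ψ → ReachesFirst xbar v x (α ψ) ψ}

/-- The Barrier: the states from which both sides can force at least a tie (capture exactly when
the evader arrives at the goal line), so that optimal play ends in a tie. -/
def barrier (xbar v : ℝ) : Set State :=
  {x | (∃ β, TeamStrategy xbar v x β ∧
      ∀ φ, Admissible xbar v x.E φ → ¬ ReachesFirst xbar v x φ (β φ)) ∧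
    ∃ α, EvaderStrategy xbar v x α ∧
      ∀ ψ, TeamAdmissible xbar v x ψ → ReachesFirstOrTie xbar v x (α ψ) ψ}

end Football

end

namespace Football

open Set

/-! ### Trajectories -/

/-! Everything is decided at one goal point `(g, 0)`: the left corner, the point `x_I`, or the right
corner, according to the position of the evader relative to the pursuers. There `B` is the squared
distance of the nearest pursuer to `(g, 0)` minus that of the evader (`exists_optimal_goal_point`).

If `B > 0`, the evader runs straight to `(g, 0)`; by the triangle inequality no pursuer can meet him
on the way. If `B = 0`, a meeting is possible only on arrival.

If `B ≤ 0`, each pursuer runs to `(g, 0)` until his abscissa equals the evader's, then copies the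
evader's horizontal velocity while moving upwards (`intercept`). The run decreases his distance to
`(g, 0)` at the maximal rate, so a pursuer at distance given by `B` is not above the evader when
they align. The evader must then pass through him to descend to the goal line
(`captured_of_aligned`). Alignment is unavoidable before the evader scores: he is confined between a
pursuer and a side of the field, or between two pursuers equidistant from `(g, 0)`.

For the converses, a winning strategy of one side is played against the other side's strategy.
Against a fixed run this is immediate; for a general evader strategy the reaction delay produces a
consistent play (`exists_play`). -/

lemma intervalIntegrable_cos {φ : ℝ → ℝ} (hφ : Measurable φ) (v a b : ℝ) :
    IntervalIntegrable (fun s => v * Real.cos (φ s)) volume a b := by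
  refine (intervalIntegrable_const (c := |v|)).mono_fun'
    (by fun_prop) (Filter.Eventually.of_forall fun s => ?_)
  simpa [abs_mul] using mul_le_of_le_one_right (abs_nonneg v) (Real.abs_cos_le_one (φ s))

lemma intervalIntegrable_sin {φ : ℝ → ℝ} (hφ : Measurable φ) (v a b : ℝ) :
    IntervalIntegrable (fun s => v * Real.sin (φ s)) volume a b := by
  refine (intervalIntegrable_const (c := |v|)).mono_fun'
    (by fun_prop) (Filter.Eventually.of_forall fun s => ?_)
  simpa [abs_mul] using mul_le_of_le_one_right (abs_nonneg v) (Real.abs_sin_le_one (φ s))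

@[simp] lemma pos_zero (v : ℝ) (p : ℝ × ℝ) (φ : ℝ → ℝ) : pos v p φ 0 = p := by
  simp [pos]

lemma pos_fst_eq_add {φ : ℝ → ℝ} (hφ : Measurable φ) (v : ℝ) (p : ℝ × ℝ) (s t : ℝ) :
    (pos v p φ t).1 = (pos v p φ s).1 + ∫ r in s..t, v * Real.cos (φ r) := by
  have := intervalIntegral.integral_add_adjacent_intervals
    (intervalIntegrable_cos hφ v 0 s) (intervalIntegrable_cos hφ v s t)
  simp only [pos]
  linarith

lemma pos_snd_eq_add {φ : ℝ → ℝ} (hφ : Measurable φ) (v : ℝ) (p : ℝ × ℝ) (s t : ℝ) :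
    (pos v p φ t).2 = (pos v p φ s).2 + ∫ r in s..t, v * Real.sin (φ r) := by
  have := intervalIntegral.integral_add_adjacent_intervals
    (intervalIntegrable_sin hφ v 0 s) (intervalIntegrable_sin hφ v s t)
  simp only [pos]
  linarith

lemma continuous_pos {φ : ℝ → ℝ} (hφ : Measurable φ) (v : ℝ) (p : ℝ × ℝ) :
    Continuous (pos v p φ) := by
  have h1 := intervalIntegral.continuous_primitive
    (fun a b => intervalIntegrable_cos hφ v a b) 0
  have h2 := intervalIntegral.continuous_primitive
    (fun a b => intervalIntegrable_sin hφ v a b) 0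
  exact (continuous_const.add h1).prodMk (continuous_const.add h2)

lemma AgreeUpTo.mono {s t : ℝ} {a b : ℝ → ℝ} (h : AgreeUpTo t a b) (hst : s ≤ t) :
    AgreeUpTo s a b :=
  ae_restrict_of_ae_restrict_of_subset (Icc_subset_Icc_right hst) h

lemma AgreeUpTo.symm {t : ℝ} {a b : ℝ → ℝ} (h : AgreeUpTo t a b) : AgreeUpTo t b a :=
  Filter.EventuallyEq.symm h

lemma AgreeUpTo.trans {t : ℝ} {a b c : ℝ → ℝ} (h : AgreeUpTo t a b) (h' : AgreeUpTo t b c) :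
    AgreeUpTo t a c := by
  filter_upwards [h, h'] with s h1 h2 using h1.trans h2

lemma AgreeUpTo.of_eqOn {t : ℝ} {a b : ℝ → ℝ} (h : ∀ s ∈ Icc 0 t, a s = b s) :
    AgreeUpTo t a b :=
  (ae_restrict_iff' measurableSet_Icc).2 (Filter.Eventually.of_forall h)

lemma AgreeUpTo.pos_eq {t : ℝ} {a b : ℝ → ℝ} (h : AgreeUpTo t a b) (ht : 0 ≤ t)
    (v : ℝ) (p : ℝ × ℝ) : pos v p a t = pos v p b t := by
  have h' := (ae_restrict_iff' measurableSet_Icc).1 h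
  have key : ∀ f : ℝ → ℝ,
      ∫ s in (0 : ℝ)..t, v * f (a s) = ∫ s in (0 : ℝ)..t, v * f (b s) := by
    intro f
    refine intervalIntegral.integral_congr_ae ?_
    filter_upwards [h'] with s hs hmem
    rw [uIoc_of_le ht] at hmem
    rw [hs ⟨hmem.1.le, hmem.2⟩]
  simp only [pos]
  rw [key Real.cos, key Real.sin]

/-- The Euclidean distance between a point and the point `(g, 0)`. -/
noncomputable def goalDist (p : ℝ × ℝ) (g : ℝ) : ℝ := ‖(⟨p.1 - g, p.2⟩ : ℂ)‖

lemma goalDist_nonneg (p : ℝ × ℝ) (g : ℝ) : 0 ≤ goalDist p g := norm_nonneg _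

lemma goalDist_sq (p : ℝ × ℝ) (g : ℝ) : goalDist p g ^ 2 = (p.1 - g) ^ 2 + p.2 ^ 2 := by
  rw [goalDist, Complex.sq_norm, Complex.normSq_apply]
  ring

lemma abs_fst_sub_le_goalDist (p : ℝ × ℝ) (g : ℝ) : |p.1 - g| ≤ goalDist p g :=
  Complex.abs_re_le_norm ⟨p.1 - g, p.2⟩

/-- The velocity has Euclidean norm `v`. Points are moved to `ℂ` because the norm of `ℝ × ℝ` is the
sup norm. -/
lemma norm_displacement_le {φ : ℝ → ℝ} (hφ : Measurable φ) {v : ℝ} (hv : 0 < v) (p : ℝ × ℝ)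
    {s t : ℝ} (hst : s ≤ t) :
    ‖(⟨(pos v p φ t).1 - (pos v p φ s).1, (pos v p φ t).2 - (pos v p φ s).2⟩ : ℂ)‖
      ≤ v * (t - s) := by
  have h1 := intervalIntegrable_cos hφ v s t
  have h2 := intervalIntegrable_sin hφ v s t
  have h1C : IntervalIntegrable (fun r => ((v * Real.cos (φ r) : ℝ) : ℂ)) volume s t :=
    ⟨h1.1.ofReal, h1.2.ofReal⟩
  have h2C : IntervalIntegrable (fun r => ((v * Real.sin (φ r) : ℝ) : ℂ)) volume s t :=
    ⟨h2.1.ofReal, h2.2.ofReal⟩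
  have hC : (⟨(pos v p φ t).1 - (pos v p φ s).1, (pos v p φ t).2 - (pos v p φ s).2⟩ : ℂ)
      = ∫ r in s..t, (((v * Real.cos (φ r) : ℝ) : ℂ) + ((v * Real.sin (φ r) : ℝ) : ℂ) *
          Complex.I) := by
    rw [intervalIntegral.integral_add h1C (h2C.mul_const _),
      intervalIntegral.integral_mul_const, intervalIntegral.integral_ofReal,
      intervalIntegral.integral_ofReal, pos_fst_eq_add hφ v p s t, pos_snd_eq_add hφ v p s t,
      ← Complex.mk_eq_add_mul_I]
    congr 1 <;> ring
  rw [hC]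
  refine (intervalIntegral.norm_integral_le_of_norm_le_const (C := v) fun r _ => ?_).trans ?_
  · rw [← Complex.mk_eq_add_mul_I, ← abs_of_pos hv, ← sq_le_sq₀ (norm_nonneg _) (abs_nonneg v),
      Complex.sq_norm, Complex.normSq_apply, sq_abs]
    simp only [abs_of_pos hv]
    nlinarith [Real.sin_sq_add_cos_sq (φ r)]
  · rw [abs_of_nonneg (sub_nonneg.2 hst)]

lemma goalDist_le_add {φ : ℝ → ℝ} (hφ : Measurable φ) {v : ℝ} (hv : 0 < v) (p : ℝ × ℝ) (g : ℝ)
    {t : ℝ} (ht : 0 ≤ t) : goalDist p g ≤ goalDist (pos v p φ t) g + v * t := by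
  have h := norm_displacement_le hφ hv p ht
  have h2 := norm_sub_le (⟨(pos v p φ t).1 - g, (pos v p φ t).2⟩ : ℂ)
    ⟨(pos v p φ t).1 - (pos v p φ 0).1, (pos v p φ t).2 - (pos v p φ 0).2⟩
  have h3 : (⟨(pos v p φ t).1 - g, (pos v p φ t).2⟩ : ℂ) -
      ⟨(pos v p φ t).1 - (pos v p φ 0).1, (pos v p φ t).2 - (pos v p φ 0).2⟩ =
      ⟨p.1 - g, p.2⟩ := by
    apply Complex.ext <;> simp
  rw [h3] at h2
  simp only [goalDist]
  linarith

/-! ### Running straight to a point of the goal line -/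

/-- Run straight to the point `(g, 0)`, and after the arrival straight up. -/
noncomputable def runTo (v : ℝ) (p : ℝ × ℝ) (g : ℝ) (t : ℝ) : ℝ :=
  if v * t < goalDist p g then Complex.arg ⟨g - p.1, -p.2⟩ else Real.pi / 2

lemma measurable_runTo (v : ℝ) (p : ℝ × ℝ) (g : ℝ) : Measurable (runTo v p g) := by
  unfold runTo
  exact Measurable.ite (measurableSet_lt (by fun_prop) measurable_const) measurable_const
    measurable_const

lemma runTo_mem (v : ℝ) (p : ℝ × ℝ) (g t : ℝ) :
    runTo v p g t ∈ Icc (-Real.pi) Real.pi := by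
  have := Real.pi_pos
  unfold runTo
  split_ifs
  · exact ⟨(Complex.neg_pi_lt_arg _).le, Complex.arg_le_pi _⟩
  · constructor <;> linarith

lemma goalDist_mul_cos (p : ℝ × ℝ) (g : ℝ) :
    goalDist p g * Real.cos (Complex.arg ⟨g - p.1, -p.2⟩) = g - p.1 := by
  have h := Complex.norm_mul_cos_arg (⟨g - p.1, -p.2⟩ : ℂ)
  have h2 : (⟨g - p.1, -p.2⟩ : ℂ) = -⟨p.1 - g, p.2⟩ := by apply Complex.ext <;> simp
  rw [goalDist, ← norm_neg, ← h2]
  exact h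

lemma goalDist_mul_sin (p : ℝ × ℝ) (g : ℝ) :
    goalDist p g * Real.sin (Complex.arg ⟨g - p.1, -p.2⟩) = -p.2 := by
  have h := Complex.norm_mul_sin_arg (⟨g - p.1, -p.2⟩ : ℂ)
  have h2 : (⟨g - p.1, -p.2⟩ : ℂ) = -⟨p.1 - g, p.2⟩ := by apply Complex.ext <;> simp
  rw [goalDist, ← norm_neg, ← h2]
  exact h

lemma pos_runTo_before {v : ℝ} (hv : 0 < v) (p : ℝ × ℝ) (g : ℝ) {t : ℝ} (ht : 0 ≤ t)
    (h : v * t ≤ goalDist p g) :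
    pos v p (runTo v p g) t =
      (p.1 + v * t * Real.cos (Complex.arg ⟨g - p.1, -p.2⟩),
        p.2 + v * t * Real.sin (Complex.arg ⟨g - p.1, -p.2⟩)) := by
  have key : ∀ f : ℝ → ℝ, ∫ s in (0 : ℝ)..t, v * f (runTo v p g s) =
      v * t * f (Complex.arg ⟨g - p.1, -p.2⟩) := by
    intro f
    rw [intervalIntegral.integral_congr_Ioo_of_le
      (g := fun _ => v * f (Complex.arg ⟨g - p.1, -p.2⟩)) ht]
    · simp; ring
    · intro s hs
      have : v * s < goalDist p g := (mul_lt_mul_of_pos_left hs.2 hv).trans_le h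
      simp [runTo, this]
  simp only [pos]
  rw [key Real.cos, key Real.sin]

lemma pos_runTo_after {v : ℝ} (hv : 0 < v) (p : ℝ × ℝ) (g : ℝ) {t : ℝ}
    (h : goalDist p g ≤ v * t) :
    pos v p (runTo v p g) t = (g, v * t - goalDist p g) := by
  set D := goalDist p g with hD
  have hDv : v * (D / v) = D := by field_simp
  have hle : D / v ≤ t := by rw [div_le_iff₀ hv]; linarith
  have key : ∀ f : ℝ → ℝ, ∫ s in (D / v)..t, v * f (runTo v p g s) =
      (v * t - D) * f (Real.pi / 2) := by
    intro f
    rw [intervalIntegral.integral_congr_Ioo_of_le (g := fun _ => v * f (Real.pi / 2)) hle]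
    · simp only [intervalIntegral.integral_const, smul_eq_mul]
      linear_combination (-f (Real.pi / 2)) * hDv
    · intro s hs
      have : ¬ v * s < goalDist p g := by
        rw [← hD, ← hDv]
        exact not_lt.2 (mul_le_mul_of_nonneg_left hs.1.le hv.le)
      simp [runTo, this]
  have h0 := pos_runTo_before hv p g (t := D / v) (div_nonneg (goalDist_nonneg _ _) hv.le)
    hDv.le
  rw [hDv, goalDist_mul_cos, goalDist_mul_sin] at h0
  have hm := measurable_runTo v p g
  ext
  · rw [pos_fst_eq_add hm v p (D / v) t, key Real.cos, h0]
    simp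
  · rw [pos_snd_eq_add hm v p (D / v) t, key Real.sin, h0]
    simp

/-- The straight run attains equality in `goalDist_le_add`: no other control approaches `(g, 0)`
faster. -/
lemma goalDist_pos_runTo {v : ℝ} (hv : 0 < v) (p : ℝ × ℝ) (g : ℝ) {t : ℝ} (ht : 0 ≤ t)
    (h : v * t ≤ goalDist p g) :
    goalDist (pos v p (runTo v p g) t) g = goalDist p g - v * t := by
  rw [← sq_eq_sq₀ (goalDist_nonneg _ _) (by linarith), goalDist_sq, pos_runTo_before hv p g ht h]
  have h1 := goalDist_mul_cos p g
  have h2 := goalDist_mul_sin p g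
  set D := goalDist p g
  set θ := Complex.arg ⟨g - p.1, -p.2⟩
  have e1 : p.1 + v * t * Real.cos θ - g = -(D - v * t) * Real.cos θ := by linear_combination h1
  have e2 : p.2 + v * t * Real.sin θ = -(D - v * t) * Real.sin θ := by linear_combination h2
  simp only
  rw [e1, e2]
  linear_combination (D - v * t) ^ 2 * Real.sin_sq_add_cos_sq θ

lemma admissible_runTo {xbar v : ℝ} (hv : 0 < v) {p : ℝ × ℝ} (hp : p ∈ field xbar) {g : ℝ}
    (hg : g ∈ Icc 0 xbar) : Admissible xbar v p (runTo v p g) := by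
  refine ⟨measurable_runTo v p g, runTo_mem v p g, fun t ht => ?_⟩
  obtain ⟨hp0, hp1, hp2⟩ := hp
  rcases le_total (goalDist p g) (v * t) with h | h
  · rw [pos_runTo_after hv p g h]
    exact ⟨hg.1, hg.2, sub_nonneg.2 h⟩
  -- The convexity argument below cancels the factor `D`, so a start at the target is treated apart.
  · rcases (goalDist_nonneg p g).eq_or_lt with h0 | hD
    · rw [pos_runTo_after hv p g (by rw [← h0]; positivity)]
      exact ⟨hg.1, hg.2, by rw [← h0]; simp; positivity⟩
    rw [pos_runTo_before hv p g ht h]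
    have h1 := goalDist_mul_cos p g
    have h2 := goalDist_mul_sin p g
    set D := goalDist p g
    set θ := Complex.arg ⟨g - p.1, -p.2⟩
    have hvt : 0 ≤ v * t := by positivity
    have e1 : D * (p.1 + v * t * Real.cos θ) = (D - v * t) * p.1 + v * t * g := by
      linear_combination v * t * h1
    have e2 : D * (p.2 + v * t * Real.sin θ) = (D - v * t) * p.2 := by
      linear_combination v * t * h2
    have hDt : 0 ≤ D - v * t := sub_nonneg.2 h
    refine ⟨?_, ?_, ?_⟩
    · refine nonneg_of_mul_nonneg_right ?_ hD
      simp only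
      rw [e1]
      exact add_nonneg (mul_nonneg hDt hp0) (mul_nonneg hvt hg.1)
    · refine le_of_mul_le_mul_left ?_ hD
      simp only
      rw [e1]
      nlinarith [mul_le_mul_of_nonneg_left hp1 hDt, mul_le_mul_of_nonneg_left hg.2 hvt]
    · refine nonneg_of_mul_nonneg_right ?_ hD
      simp only
      rw [e2]
      exact mul_nonneg hDt hp2

/-! ### The evader -/

lemma runTo_not_captured {v : ℝ} (hv : 0 < v) {p q : ℝ × ℝ} {g : ℝ}
    (h : goalDist p g < goalDist q g) {ψ : ℝ → ℝ} (hψ : Measurable ψ) {s : ℝ} (hs : 0 ≤ s)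
    (hs' : v * s ≤ goalDist p g) : pos v q ψ s ≠ pos v p (runTo v p g) s := by
  intro hc
  have h1 := goalDist_le_add hψ hv q g hs
  rw [hc, goalDist_pos_runTo hv p g hs hs'] at h1
  linarith

/-- At time `s` the disc of radius `v * s` about the runner lies inside the disc of radius `goalDist
p g` about `(g, 0)` and touches its boundary only at `p`. A capturing pursuer would have started in
the small disc but not inside the large one, hence at `p`. -/
lemma runTo_not_captured_before {v : ℝ} (hv : 0 < v) {p q : ℝ × ℝ} {g : ℝ} (hpq : p ≠ q)
    (h : goalDist p g ≤ goalDist q g) {ψ : ℝ → ℝ} (hψ : Measurable ψ) {s : ℝ} (hs : 0 ≤ s)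
    (hs' : v * s < goalDist p g) : pos v q ψ s ≠ pos v p (runTo v p g) s := by
  intro hc
  have hd := norm_displacement_le hψ hv q hs
  rw [pos_zero, hc, pos_runTo_before hv p g hs hs'.le, sub_zero] at hd
  have hvs : 0 ≤ v * s := by positivity
  rw [← sq_le_sq₀ (norm_nonneg _) hvs, Complex.sq_norm, Complex.normSq_apply] at hd
  have hD := (sq_le_sq₀ (goalDist_nonneg _ _) (goalDist_nonneg _ _)).2 h
  rw [goalDist_sq q] at hD
  have h1 := goalDist_mul_cos p g
  have h2 := goalDist_mul_sin p g
  set D := goalDist p g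
  set c := Real.cos (Complex.arg ⟨g - p.1, -p.2⟩)
  set k := Real.sin (Complex.arg ⟨g - p.1, -p.2⟩)
  have hck : k ^ 2 + c ^ 2 = 1 := Real.sin_sq_add_cos_sq _
  simp only at hd
  set r := v * s
  set a := q.1 - p.1 with ha
  set b := q.2 - p.2 with hb
  have e1 : q.1 - g = a - D * c := by rw [h1]; ring
  have e2 : q.2 = b - D * k := by rw [h2]; ring
  have e3 : p.1 + r * c - q.1 = r * c - a := by ring
  have e4 : p.2 + r * k - q.2 = r * k - b := by ring
  rw [e1, e2] at hD
  rw [e3, e4] at hd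
  -- With `w = q - p` and `u` the running direction, `2 D w·u ≤ |w|² ≤ 2 r w·u`; as `r < D`, this
  -- forces `w = 0`.
  have hw : 2 * D * (a * c + b * k) ≤ a ^ 2 + b ^ 2 := by
    linear_combination hD + D ^ 2 * hck
  have hw2 : a ^ 2 + b ^ 2 ≤ 2 * r * (a * c + b * k) := by
    linear_combination hd - r ^ 2 * hck
  have h0 : a * c + b * k ≤ 0 := by
    by_contra hpos
    nlinarith
  have hz : a ^ 2 + b ^ 2 ≤ 0 := by nlinarith
  have ha0 : a = 0 := by nlinarith [sq_nonneg a, sq_nonneg b]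
  have hb0 : b = 0 := by nlinarith [sq_nonneg a, sq_nonneg b]
  exact hpq (Prod.ext (by linarith) (by linarith))

lemma runTo_atGoal {xbar v : ℝ} (hv : 0 < v) (x : State) {g : ℝ} (hg : g ∈ Icc 0 xbar) :
    AtGoal xbar v x (runTo v x.E g) (goalDist x.E g / v) := by
  have h : v * (goalDist x.E g / v) = goalDist x.E g := by field_simp
  rw [AtGoal, pos_runTo_after hv _ _ h.ge, h]
  simpa [goal, field] using hg

lemma runTo_reachesFirst {xbar v : ℝ} (hv : 0 < v) {x : State} {g : ℝ} (hg : g ∈ Icc 0 xbar)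
    (h1 : goalDist x.E g < goalDist x.P1 g) (h2 : goalDist x.E g < goalDist x.P2 g)
    {ψ : (ℝ → ℝ) × (ℝ → ℝ)} (hψ : TeamAdmissible xbar v x ψ) :
    ReachesFirst xbar v x (runTo v x.E g) ψ := by
  refine ⟨_, div_nonneg (goalDist_nonneg _ _) hv.le, runTo_atGoal hv x hg, fun s hs hst => ?_⟩
  have hs' : v * s ≤ goalDist x.E g := by rwa [le_div_iff₀ hv, mul_comm] at hst
  rintro (hc | hc)
  · exact runTo_not_captured hv h1 hψ.1.1 hs hs' hc
  · exact runTo_not_captured hv h2 hψ.2.1 hs hs' hc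

lemma runTo_reachesFirstOrTie {xbar v : ℝ} (hv : 0 < v) {x : State} (hE1 : x.E ≠ x.P1)
    (hE2 : x.E ≠ x.P2) {g : ℝ} (hg : g ∈ Icc 0 xbar)
    (h1 : goalDist x.E g ≤ goalDist x.P1 g) (h2 : goalDist x.E g ≤ goalDist x.P2 g)
    {ψ : (ℝ → ℝ) × (ℝ → ℝ)} (hψ : TeamAdmissible xbar v x ψ) :
    ReachesFirstOrTie xbar v x (runTo v x.E g) ψ := by
  refine ⟨_, div_nonneg (goalDist_nonneg _ _) hv.le, runTo_atGoal hv x hg, fun s hs hst => ?_⟩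
  have hs' : v * s < goalDist x.E g := by rwa [lt_div_iff₀ hv, mul_comm] at hst
  rintro (hc | hc)
  · exact runTo_not_captured_before hv hE1 h1 hψ.1.1 hs hs' hc
  · exact runTo_not_captured_before hv hE2 h2 hψ.2.1 hs hs' hc

lemma evaderStrategy_const {xbar v : ℝ} {x : State} {φ : ℝ → ℝ}
    (hφ : Admissible xbar v x.E φ) : EvaderStrategy xbar v x fun _ => φ :=
  ⟨fun _ _ => hφ, 1, one_pos, fun _ _ _ _ _ _ _ => AgreeUpTo.of_eqOn fun _ _ => rfl⟩

/-! ### The pursuers -/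

/-- By time `t`, a player running from `p` to `(g, 0)` and the evader starting at `e` have had the
same abscissa. -/
def Aligned (v : ℝ) (p e : ℝ × ℝ) (g : ℝ) (φ : ℝ → ℝ) (t : ℝ) : Prop :=
  ∃ s ∈ Icc 0 t, (pos v p (runTo v p g) s).1 = (pos v e φ s).1

lemma Aligned.mono {v : ℝ} {p e : ℝ × ℝ} {g : ℝ} {φ : ℝ → ℝ} {s t : ℝ}
    (h : Aligned v p e g φ s) (hst : s ≤ t) : Aligned v p e g φ t := by
  obtain ⟨r, hr, h⟩ := h
  exact ⟨r, ⟨hr.1, hr.2.trans hst⟩, h⟩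

open Classical in
/-- Run to `(g, 0)` until aligned with the evader; from then on keep the abscissa of the evader
while moving upwards. -/
noncomputable def intercept (v : ℝ) (p e : ℝ × ℝ) (g : ℝ) (φ : ℝ → ℝ) (t : ℝ) : ℝ :=
  if Aligned v p e g φ t then |φ t| else runTo v p g t

lemma measurable_intercept (v : ℝ) (p e : ℝ × ℝ) (g : ℝ) {φ : ℝ → ℝ} (hφ : Measurable φ) :
    Measurable (intercept v p e g φ) := by
  -- Alignment is never lost, so the switching set is a half-line or trivial.
  have hU : IsUpperSet {t | Aligned v p e g φ t} := fun _ _ hab h => h.mono hab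
  exact Measurable.ite hU.ordConnected.measurableSet hφ.abs (measurable_runTo v p g)

lemma pos_intercept_of_not_aligned {v : ℝ} {p e : ℝ × ℝ} {g : ℝ} {φ : ℝ → ℝ} {t : ℝ}
    (ht : 0 ≤ t) (h : ¬ Aligned v p e g φ t) :
    pos v p (intercept v p e g φ) t = pos v p (runTo v p g) t :=
  AgreeUpTo.pos_eq (AgreeUpTo.of_eqOn fun s hs => by
    rw [intercept, if_neg fun h' => h (h'.mono hs.2)]) ht v p

/-- From the first alignment on, the heading is `|φ|`: cosine is even, so the abscissas stay equal,
and `sin |φ| = |sin φ|` on `[-π, π]`, so neither the pursuer's height nor the sum of the two heights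
decreases. -/
lemma exists_first_alignment {xbar v : ℝ} (hv : 0 < v) {p e : ℝ × ℝ} {g : ℝ} {φ : ℝ → ℝ}
    (hφ : Admissible xbar v e φ) {t : ℝ} (h : Aligned v p e g φ t) :
    ∃ s ∈ Icc 0 t, pos v p (intercept v p e g φ) s = pos v p (runTo v p g) s ∧
      (pos v p (runTo v p g) s).1 = (pos v e φ s).1 ∧
      ∀ r, s ≤ r → (pos v p (intercept v p e g φ) r).1 = (pos v e φ r).1 ∧
        (pos v p (intercept v p e g φ) s).2 ≤ (pos v p (intercept v p e g φ) r).2 ∧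
        (pos v p (intercept v p e g φ) s).2 + (pos v e φ s).2 ≤
          (pos v p (intercept v p e g φ) r).2 + (pos v e φ r).2 := by
  have hm := measurable_runTo v p g
  have hi := measurable_intercept v p e g hφ.1
  have hclosed : IsClosed {s | (pos v p (runTo v p g) s).1 = (pos v e φ s).1} :=
    isClosed_eq (continuous_pos hm v p).fst (continuous_pos hφ.1 v e).fst
  obtain ⟨s, ⟨⟨hs0, hst⟩, hs⟩, hmin⟩ := (isCompact_Icc.inter_right hclosed).exists_isLeast
    (s := Icc 0 t ∩ {s | (pos v p (runTo v p g) s).1 = (pos v e φ s).1})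
    (by obtain ⟨s, h1, h2⟩ := h; exact ⟨s, h1, h2⟩)
  have hpos : pos v p (intercept v p e g φ) s = pos v p (runTo v p g) s := by
    refine AgreeUpTo.pos_eq ?_ hs0 v p
    -- At `s` itself the control has already switched; this endpoint is a null set.
    rw [AgreeUpTo, ← Measure.restrict_congr_set (Ico_ae_eq_Icc (μ := volume) (a := 0) (b := s)),
      ae_restrict_iff' measurableSet_Ico]
    refine Filter.Eventually.of_forall fun r hr => ?_
    rw [intercept, if_neg]
    rintro ⟨r', hr', h'⟩
    have := hmin ⟨⟨hr'.1, by linarith [hr'.2, hr.2]⟩, h'⟩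
    linarith [hr'.2, hr.2]
  refine ⟨s, ⟨hs0, hst⟩, hpos, hs, fun r hr => ?_⟩
  have heq : ∀ q ∈ Icc s r, intercept v p e g φ q = |φ q| := fun q hq => by
    rw [intercept, if_pos ⟨s, ⟨hs0, hq.1⟩, hs⟩]
  have hsin : ∀ q ∈ Icc s r, 0 ≤ v * Real.sin (intercept v p e g φ q) := fun q hq => by
    rw [heq q hq]
    exact mul_nonneg hv.le (Real.sin_nonneg_of_nonneg_of_le_pi (abs_nonneg _)
      (abs_le.2 (hφ.2.1 q)))
  refine ⟨?_, ?_, ?_⟩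
  · rw [pos_fst_eq_add hi v p s r, pos_fst_eq_add hφ.1 v e s r, hpos, hs]
    congr 1
    refine intervalIntegral.integral_congr fun q hq => ?_
    rw [uIcc_of_le hr] at hq
    simp only [heq q hq, Real.cos_abs]
  · rw [pos_snd_eq_add hi v p s r]
    exact le_add_of_nonneg_right (intervalIntegral.integral_nonneg hr hsin)
  · have h0 : 0 ≤ ∫ q in s..r, (v * Real.sin (intercept v p e g φ q) + v * Real.sin (φ q)) := by
      refine intervalIntegral.integral_nonneg hr fun q hq => ?_
      have h1 := hsin q hq
      rw [heq q hq] at h1 ⊢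
      rcases abs_choice (φ q) with h2 | h2 <;> rw [h2] at h1 ⊢
      · linarith
      · rw [Real.sin_neg]; linarith
    rw [intervalIntegral.integral_add (intervalIntegrable_sin hi v s r)
      (intervalIntegrable_sin hφ.1 v s r)] at h0
    rw [pos_snd_eq_add hi v p s r, pos_snd_eq_add hφ.1 v e s r]
    linarith

lemma admissible_intercept {xbar v : ℝ} (hv : 0 < v) {p e : ℝ × ℝ} (hp : p ∈ field xbar) {g : ℝ}
    (hg : g ∈ Icc 0 xbar) {φ : ℝ → ℝ} (hφ : Admissible xbar v e φ) :
    Admissible xbar v p (intercept v p e g φ) := by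
  refine ⟨measurable_intercept v p e g hφ.1, fun t => ?_, fun t ht => ?_⟩
  · unfold intercept
    split_ifs
    · exact ⟨by linarith [Real.pi_pos, abs_nonneg (φ t)], abs_le.2 (hφ.2.1 t)⟩
    · exact runTo_mem v p g t
  · have hrun := (admissible_runTo hv hp hg).2.2
    by_cases h : Aligned v p e g φ t
    · obtain ⟨s, hs, h1, -, h2⟩ := exists_first_alignment hv hφ h
      obtain ⟨h3, h4, -⟩ := h2 t hs.2
      have hE := hφ.2.2 t ht
      refine ⟨h3 ▸ hE.1, h3 ▸ hE.2.1, le_trans ?_ h4⟩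
      rw [h1]
      exact (hrun s hs.1).2.2
    · rw [pos_intercept_of_not_aligned ht h]
      exact hrun t ht

lemma AgreeUpTo.aligned {v : ℝ} {p e : ℝ × ℝ} {g : ℝ} {φ φ' : ℝ → ℝ} {t : ℝ}
    (h : AgreeUpTo t φ φ') (hal : Aligned v p e g φ t) : Aligned v p e g φ' t := by
  obtain ⟨s, hs, hal⟩ := hal
  exact ⟨s, hs, by rw [hal, (h.mono hs.2).pos_eq hs.1]⟩

lemma AgreeUpTo.intercept {v : ℝ} {p e : ℝ × ℝ} {g : ℝ} {φ φ' : ℝ → ℝ} {t : ℝ}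
    (h : AgreeUpTo t φ φ') :
    AgreeUpTo t (intercept v p e g φ) (intercept v p e g φ') := by
  filter_upwards [h, ae_restrict_mem measurableSet_Icc] with s hs hmem
  have hiff : Aligned v p e g φ s ↔ Aligned v p e g φ' s :=
    ⟨(h.mono hmem.2).aligned, (h.mono hmem.2).symm.aligned⟩
  unfold Football.intercept
  by_cases hal : Aligned v p e g φ s
  · rw [if_pos hal, if_pos (hiff.1 hal), hs]
  · rw [if_neg hal, if_neg (mt hiff.2 hal)]

lemma teamStrategy_intercept {xbar v : ℝ} (hv : 0 < v) {x : State} (h1 : x.P1 ∈ field xbar)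
    (h2 : x.P2 ∈ field xbar) {g : ℝ} (hg : g ∈ Icc 0 xbar) :
    TeamStrategy xbar v x fun φ => (intercept v x.P1 x.E g φ, intercept v x.P2 x.E g φ) :=
  ⟨fun _ hφ => ⟨admissible_intercept hv h1 hg hφ, admissible_intercept hv h2 hg hφ⟩,
    fun _ _ _ _ _ _ h => ⟨h.intercept, h.intercept⟩⟩

/-- A pursuer who gets aligned with the evader before reaching `(g, 0)` captures him before he
crosses the goal line. -/
lemma captured_of_aligned {xbar v : ℝ} (hv : 0 < v) {p e : ℝ × ℝ} (hp : p ∈ field xbar) {g : ℝ}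
    (hg : g ∈ Icc 0 xbar) {φ : ℝ → ℝ} (hφ : Admissible xbar v e φ)
    (hle : goalDist p g ≤ goalDist e g) {m t : ℝ} (hmt : m ≤ t) (hm : v * m ≤ goalDist p g)
    (hal : Aligned v p e g φ m) (hgoal : (pos v e φ t).2 = 0) :
    (∃ r ∈ Icc 0 t, pos v p (intercept v p e g φ) r = pos v e φ r) ∧
      (goalDist p g < goalDist e g →
        ∃ r ∈ Ico 0 t, pos v p (intercept v p e g φ) r = pos v e φ r) := by
  obtain ⟨s, hs, hpos, hx, hr⟩ := exists_first_alignment hv hφ hal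
  have hst : s ≤ t := hs.2.trans hmt
  have hvs : v * s ≤ goalDist p g := (mul_le_mul_of_nonneg_left hs.2 hv.le).trans hm
  have hP := (admissible_runTo hv hp hg).2.2 s hs.1
  have hE := hφ.2.2 s hs.1
  have hd := goalDist_pos_runTo hv p g hs.1 hvs
  have hd' := goalDist_le_add hφ.1 hv e g hs.1
  have hPt := (admissible_intercept hv hp hg hφ).2.2 t (hs.1.trans hst)
  have hcont : ContinuousOn (fun r => (pos v e φ r).2 - (pos v p (intercept v p e g φ) r).2)
      (Icc s t) :=
    ((continuous_pos hφ.1 v e).snd.sub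
      (continuous_pos (measurable_intercept v p e g hφ.1) v p).snd).continuousOn
  have hsq1 := goalDist_sq (pos v p (runTo v p g) s) g
  have hsq2 := goalDist_sq (pos v e φ s) g
  rw [hx] at hsq1
  have hcap : ∀ r, s ≤ r → (pos v e φ r).2 - (pos v p (intercept v p e g φ) r).2 = 0 →
      pos v p (intercept v p e g φ) r = pos v e φ r := fun r hsr h0 =>
    Prod.ext (hr r hsr).1 (sub_eq_zero.1 h0).symm
  refine ⟨?_, fun hlt => ?_⟩
  -- With equal abscissas, comparing distances to `(g, 0)` amounts to comparing heights.
  · have hy : (pos v p (runTo v p g) s).2 ≤ (pos v e φ s).2 := by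
      rw [← sq_le_sq₀ hP.2.2 hE.2.2]
      have := (sq_le_sq₀ (goalDist_nonneg (pos v p (runTo v p g) s) g)
        (goalDist_nonneg (pos v e φ s) g)).2 (by linarith)
      linarith
    obtain ⟨r, hr1, hr2⟩ := intermediate_value_Icc' hst hcont
      (show (0 : ℝ) ∈ _ from ⟨by rw [hgoal, zero_sub]; exact neg_nonpos.2 hPt.2.2,
        by rw [hpos]; exact sub_nonneg.2 hy⟩)
    exact ⟨r, ⟨hs.1.trans hr1.1, hr1.2⟩, hcap r hr1.1 hr2⟩
  · have hy : (pos v p (runTo v p g) s).2 < (pos v e φ s).2 := by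
      rw [← sq_lt_sq₀ hP.2.2 hE.2.2]
      have := (sq_lt_sq₀ (goalDist_nonneg (pos v p (runTo v p g) s) g)
        (goalDist_nonneg (pos v e φ s) g)).2 (by linarith)
      linarith
    -- The sum of heights is positive at alignment and does not decrease, so the pursuer is strictly
    -- above the goal line at time `t`; the crossing occurs before `t`.
    have hsum := (hr t hst).2.2
    rw [hpos, hgoal] at hsum
    have hneg : (pos v e φ t).2 - (pos v p (intercept v p e g φ) t).2 < 0 := by
      rw [hgoal]
      linarith [hP.2.2]
    obtain ⟨r, hr1, hr2⟩ := intermediate_value_Icc' hst hcont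
      (show (0 : ℝ) ∈ _ from ⟨hneg.le, by rw [hpos]; exact sub_nonneg.2 hy.le⟩)
    refine ⟨r, ⟨hs.1.trans hr1.1, hr1.2.lt_of_ne ?_⟩, hcap r hr1.1 hr2⟩
    rintro rfl
    exact hneg.ne hr2

/-! ### Alignment is forced before the evader scores -/

lemma pos_of_forall_ne_zero {f : ℝ → ℝ} (hf : Continuous f) (h0 : 0 ≤ f 0) {m : ℝ} (hm : 0 ≤ m)
    (h : ∀ s ∈ Icc 0 m, f s ≠ 0) : 0 < f m := by
  by_contra! hneg
  obtain ⟨r, hr, hr0⟩ := intermediate_value_Icc' hm hf.continuousOn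
    (show (0 : ℝ) ∈ _ from ⟨hneg, h0⟩)
  exact h r hr hr0

lemma fst_lt_of_not_aligned {v : ℝ} {p e : ℝ × ℝ} {g : ℝ} {φ : ℝ → ℝ} (hφ : Measurable φ)
    {m : ℝ} (hm : 0 ≤ m) (h : ¬ Aligned v p e g φ m) (hle : e.1 ≤ p.1) :
    (pos v e φ m).1 < (pos v p (runTo v p g) m).1 := by
  refine sub_pos.1 (pos_of_forall_ne_zero
    (f := fun s => (pos v p (runTo v p g) s).1 - (pos v e φ s).1)
    ((continuous_pos (measurable_runTo v p g) v p).fst.sub (continuous_pos hφ v e).fst)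
    (by simpa using hle) hm fun s hs h0 => h ⟨s, hs, sub_eq_zero.1 h0⟩)

lemma lt_fst_of_not_aligned {v : ℝ} {p e : ℝ × ℝ} {g : ℝ} {φ : ℝ → ℝ} (hφ : Measurable φ)
    {m : ℝ} (hm : 0 ≤ m) (h : ¬ Aligned v p e g φ m) (hle : p.1 ≤ e.1) :
    (pos v p (runTo v p g) m).1 < (pos v e φ m).1 := by
  refine sub_pos.1 (pos_of_forall_ne_zero
    (f := fun s => (pos v e φ s).1 - (pos v p (runTo v p g) s).1)
    ((continuous_pos hφ v e).fst.sub (continuous_pos (measurable_runTo v p g) v p).fst)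
    (by simpa using hle) hm fun s hs h0 => h ⟨s, hs, (sub_eq_zero.1 h0).symm⟩)

/-- A player who is not farther from `(g, 0)` than the evader and runs there stays, until his
arrival, at least as close to `(g, 0)` as the goal points that the evader reaches. -/
lemma abs_fst_sub_le_of_atGoal {v : ℝ} (hv : 0 < v) {p e : ℝ × ℝ} {g : ℝ} {φ : ℝ → ℝ}
    (hφ : Measurable φ) (hle : goalDist p g ≤ goalDist e g) {t : ℝ} (ht : 0 ≤ t)
    (hvt : v * t ≤ goalDist p g) (hgoal : (pos v e φ t).2 = 0) :
    |(pos v p (runTo v p g) t).1 - g| ≤ |(pos v e φ t).1 - g| := by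
  have h1 := abs_fst_sub_le_goalDist (pos v p (runTo v p g) t) g
  have h2 := goalDist_pos_runTo hv p g ht hvt
  have h3 := goalDist_le_add hφ hv e g ht
  have h4 : goalDist (pos v e φ t) g = |(pos v e φ t).1 - g| := by
    rw [← sq_eq_sq₀ (goalDist_nonneg _ _) (abs_nonneg _), goalDist_sq, hgoal, sq_abs]
    ring
  linarith

/-- At the time `min t (goalDist p g / v)` either the run to `(g, 0)` has just ended or the
evader is at the goal line. -/
lemma arrived_or_abs_le {v : ℝ} (hv : 0 < v) {p e : ℝ × ℝ} {g : ℝ} {φ : ℝ → ℝ}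
    (hφ : Measurable φ) (hle : goalDist p g ≤ goalDist e g) {t : ℝ} (ht : 0 ≤ t)
    (hgoal : (pos v e φ t).2 = 0) {m : ℝ} (hm : m = min t (goalDist p g / v)) :
    (pos v p (runTo v p g) m).1 = g ∨
      |(pos v p (runTo v p g) m).1 - g| ≤ |(pos v e φ m).1 - g| := by
  rcases le_total t (goalDist p g / v) with h | h
  · rw [min_eq_left h] at hm
    subst hm
    rw [le_div_iff₀ hv, mul_comm] at h
    exact Or.inr (abs_fst_sub_le_of_atGoal hv hφ hle ht h hgoal)
  · rw [min_eq_right h] at hm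
    left
    rw [hm, pos_runTo_after hv p g (by rw [mul_div_cancel₀ _ hv.ne'])]

/-- Without alignment the evader stays strictly to the left of the runner. So he is outside the
field if the runner is at the corner, and nearer to the corner than the runner if he is himself on
the goal line; neither is possible. -/
lemma aligned_of_left_corner {xbar v : ℝ} (hv : 0 < v) {p e : ℝ × ℝ} {φ : ℝ → ℝ}
    (hφ : Admissible xbar v e φ) (hep : e.1 ≤ p.1) (hle : goalDist p 0 ≤ goalDist e 0) {t : ℝ}
    (ht : 0 ≤ t) (hgoal : (pos v e φ t).2 = 0) :
    Aligned v p e 0 φ (min t (goalDist p 0 / v)) := by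
  by_contra h
  have hm : 0 ≤ min t (goalDist p 0 / v) := le_min ht (div_nonneg (goalDist_nonneg _ _) hv.le)
  have h1 := fst_lt_of_not_aligned hφ.1 hm h hep
  have h2 := (hφ.2.2 _ hm).1
  rcases arrived_or_abs_le hv hφ.1 hle ht hgoal rfl with h3 | h3
  · linarith
  · rw [sub_zero, sub_zero, abs_of_nonneg h2, abs_of_nonneg (h2.trans h1.le)] at h3
    linarith

lemma aligned_of_right_corner {xbar v : ℝ} (hv : 0 < v) {p e : ℝ × ℝ} {φ : ℝ → ℝ}
    (hφ : Admissible xbar v e φ) (hpe : p.1 ≤ e.1) (hle : goalDist p xbar ≤ goalDist e xbar)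
    {t : ℝ} (ht : 0 ≤ t) (hgoal : (pos v e φ t).2 = 0) :
    Aligned v p e xbar φ (min t (goalDist p xbar / v)) := by
  by_contra h
  have hm : 0 ≤ min t (goalDist p xbar / v) :=
    le_min ht (div_nonneg (goalDist_nonneg _ _) hv.le)
  have h1 := lt_fst_of_not_aligned hφ.1 hm h hpe
  have h2 := (hφ.2.2 _ hm).2.1
  rcases arrived_or_abs_le hv hφ.1 hle ht hgoal rfl with h3 | h3
  · linarith
  · rw [abs_of_nonpos (by linarith), abs_of_nonpos (by linarith)] at h3
    linarith

/-- Equal distances make both runs end at the same time. If neither runner were aligned, the evader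
would be strictly between them; the alternative of `arrived_or_abs_le` for `p` puts him to the right
of `g`, that for `q` to the left. -/
lemma aligned_of_between {v : ℝ} (hv : 0 < v) {p q e : ℝ × ℝ} {g : ℝ} {φ : ℝ → ℝ}
    (hφ : Measurable φ) (hpe : p.1 ≤ e.1) (heq : e.1 ≤ q.1)
    (hpq : goalDist p g = goalDist q g) (hle : goalDist p g ≤ goalDist e g) {t : ℝ}
    (ht : 0 ≤ t) (hgoal : (pos v e φ t).2 = 0) :
    Aligned v p e g φ (min t (goalDist p g / v)) ∨
      Aligned v q e g φ (min t (goalDist q g / v)) := by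
  by_contra! h
  have hm : 0 ≤ min t (goalDist p g / v) := le_min ht (div_nonneg (goalDist_nonneg _ _) hv.le)
  have h1 := lt_fst_of_not_aligned hφ hm h.1 hpe
  have h2 := fst_lt_of_not_aligned hφ (by rwa [← hpq]) h.2 heq
  have h3 := arrived_or_abs_le hv hφ hle ht hgoal rfl
  have h4 := arrived_or_abs_le hv hφ (hpq ▸ hle) ht hgoal rfl
  rw [← hpq] at h2 h4
  grind

/-- The point of the goal line that both sides aim at. -/
lemma exists_optimal_goal_point {xbar v : ℝ} (hv : 0 < v) {x : State} (hE : x.E ∈ field xbar)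
    (h12 : x.x1 < x.x2) (hI0 : x.xE < x.x2 → 0 ≤ x.xI) (hI1 : x.x1 < x.xE → x.xI ≤ xbar) :
    ∃ g ∈ Icc 0 xbar,
      B xbar x ≤ goalDist x.P1 g ^ 2 - goalDist x.E g ^ 2 ∧
      B xbar x ≤ goalDist x.P2 g ^ 2 - goalDist x.E g ^ 2 ∧
      (B xbar x ≤ 0 → ∀ φ, Admissible xbar v x.E φ → ∀ t, 0 ≤ t → AtGoal xbar v x φ t →
        (goalDist x.P1 g ^ 2 - goalDist x.E g ^ 2 = B xbar x ∧
          Aligned v x.P1 x.E g φ (min t (goalDist x.P1 g / v))) ∨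
        (goalDist x.P2 g ^ 2 - goalDist x.E g ^ 2 = B xbar x ∧
          Aligned v x.P2 x.E g φ (min t (goalDist x.P2 g / v)))) := by
  have hx : 0 ≤ xbar := hE.1.trans hE.2.1
  have hxI : 2 * x.xI * (x.x2 - x.x1) = x.x2 ^ 2 + x.y2 ^ 2 - x.x1 ^ 2 - x.y1 ^ 2 := by
    have : x.x2 - x.x1 ≠ 0 := (sub_pos.2 h12).ne'
    rw [State.xI]
    field_simp
  have hle : ∀ {p : ℝ × ℝ} {g : ℝ}, goalDist p g ^ 2 - goalDist x.E g ^ 2 = B xbar x →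
      B xbar x ≤ 0 → goalDist p g ≤ goalDist x.E g := fun h h0 => by
    rw [← sq_le_sq₀ (goalDist_nonneg _ _) (goalDist_nonneg _ _)]
    linarith
  by_cases h1 : x.xE ≤ x.x1
  · have hB : goalDist x.P1 0 ^ 2 - goalDist x.E 0 ^ 2 = B xbar x := by
      rw [B, if_pos h1, goalDist_sq, goalDist_sq]
      simp only [State.P1, State.E, B1]
      ring
    refine ⟨0, ⟨le_rfl, hx⟩, hB.ge, ?_, fun h0 φ hφ t ht hg => Or.inl ⟨hB, ?_⟩⟩
    -- By `hxI`, the squared distances of `P₂` and `P₁` to the left corner differ by `2 x_I (x₂ -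
    -- x₁) ≥ 0`.
    · have := mul_nonneg (hI0 (h1.trans_lt h12)) (sub_pos.2 h12).le
      rw [← hB, goalDist_sq x.P1, goalDist_sq x.P2]
      simp only [State.P1, State.P2]
      linarith
    · exact aligned_of_left_corner (p := x.P1) hv hφ h1 (hle hB h0) ht hg.2
  by_cases h2 : x.xE < x.x2
  · have hB : goalDist x.P1 x.xI ^ 2 - goalDist x.E x.xI ^ 2 = B xbar x := by
      rw [B, if_neg h1, if_pos h2, goalDist_sq, goalDist_sq]
      simp only [State.P1, State.E, B2]
      ring
    have h21 : goalDist x.P1 x.xI = goalDist x.P2 x.xI := by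
      rw [← sq_eq_sq₀ (goalDist_nonneg _ _) (goalDist_nonneg _ _), goalDist_sq, goalDist_sq]
      simp only [State.P1, State.P2]
      linear_combination hxI
    refine ⟨x.xI, ⟨hI0 h2, hI1 (not_le.1 h1)⟩, hB.ge, (h21 ▸ hB).ge, fun h0 φ hφ t ht hg => ?_⟩
    exact (aligned_of_between hv hφ.1 (not_le.1 h1).le h2.le h21 (hle hB h0) ht hg.2).imp
      (fun h => ⟨hB, h⟩) fun h => ⟨h21 ▸ hB, h⟩
  · have hB : goalDist x.P2 xbar ^ 2 - goalDist x.E xbar ^ 2 = B xbar x := by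
      rw [B, if_neg h1, if_neg h2, goalDist_sq, goalDist_sq]
      simp only [State.P2, State.E, B3]
      ring
    refine ⟨xbar, ⟨hx, le_rfl⟩, ?_, hB.ge, fun h0 φ hφ t ht hg => Or.inr ⟨hB, ?_⟩⟩
    -- At the right corner the corresponding difference, `P₁` minus `P₂`, is `2 (x̄ - x_I) (x₂ -
    -- x₁)`.
    · have := mul_nonneg (sub_nonneg.2 (hI1 (not_le.1 h1))) (sub_pos.2 h12).le
      rw [← hB, goalDist_sq x.P1, goalDist_sq x.P2]
      simp only [State.P1, State.P2]
      linarith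
    · exact aligned_of_right_corner (p := x.P2) hv hφ (le_of_not_gt h2) (hle hB h0) ht hg.2

/-- If the Barrier function is nonpositive, the pursuers can capture the evader not later than on
the goal line, and if it is negative, before. -/
lemma exists_teamStrategy {xbar v : ℝ} (hv : 0 < v) {x : State} (hE : x.E ∈ field xbar)
    (hP1 : x.P1 ∈ field xbar) (hP2 : x.P2 ∈ field xbar)
    (h12 : x.x1 < x.x2) (hI0 : x.xE < x.x2 → 0 ≤ x.xI) (hI1 : x.x1 < x.xE → x.xI ≤ xbar)
    (hB : B xbar x ≤ 0) :
    ∃ β, TeamStrategy xbar v x β ∧ ∀ φ, Admissible xbar v x.E φ →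
      ¬ ReachesFirst xbar v x φ (β φ) ∧
      (B xbar x < 0 → ¬ ReachesFirstOrTie xbar v x φ (β φ)) := by
  obtain ⟨g, hg, -, -, hal⟩ := exists_optimal_goal_point hv hE h12 hI0 hI1
  refine ⟨_, teamStrategy_intercept hv hP1 hP2 hg, fun φ hφ => ?_⟩
  have hcap : ∀ {p : ℝ × ℝ}, p ∈ field xbar → ∀ {t}, AtGoal xbar v x φ t →
      goalDist p g ^ 2 - goalDist x.E g ^ 2 = B xbar x →
      Aligned v p x.E g φ (min t (goalDist p g / v)) →
      (∃ r ∈ Icc 0 t, pos v p (intercept v p x.E g φ) r = pos v x.E φ r) ∧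
        (B xbar x < 0 → ∃ r ∈ Ico 0 t, pos v p (intercept v p x.E g φ) r = pos v x.E φ r) := by
    intro p hp t hgoal hBp hal
    have hm : v * min t (goalDist p g / v) ≤ goalDist p g := by
      refine (mul_le_mul_of_nonneg_left (min_le_right _ _) hv.le).trans_eq ?_
      field_simp
    have hle : goalDist p g ≤ goalDist x.E g := by
      rw [← sq_le_sq₀ (goalDist_nonneg _ _) (goalDist_nonneg _ _)]
      linarith
    refine (captured_of_aligned hv hp hg hφ hle (min_le_left _ _) hm hal hgoal.2).imp_right
      fun h hneg => h ?_
    rw [← sq_lt_sq₀ (goalDist_nonneg _ _) (goalDist_nonneg _ _)]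
    linarith
  refine ⟨?_, fun hneg => ?_⟩
  · rintro ⟨t, ht, hgoal, hno⟩
    rcases hal hB φ hφ t ht hgoal with ⟨h1, h2⟩ | ⟨h1, h2⟩
    · obtain ⟨r, hr, h⟩ := (hcap hP1 hgoal h1 h2).1
      exact hno r hr.1 hr.2 (Or.inl h)
    · obtain ⟨r, hr, h⟩ := (hcap hP2 hgoal h1 h2).1
      exact hno r hr.1 hr.2 (Or.inr h)
  · rintro ⟨t, ht, hgoal, hno⟩
    rcases hal hB φ hφ t ht hgoal with ⟨h1, h2⟩ | ⟨h1, h2⟩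
    · obtain ⟨r, hr, h⟩ := (hcap hP1 hgoal h1 h2).2 hneg
      exact hno r hr.1 hr.2 (Or.inl h)
    · obtain ⟨r, hr, h⟩ := (hcap hP2 hgoal h1 h2).2 hneg
      exact hno r hr.1 hr.2 (Or.inr h)

/-! ### The play determined by a pair of strategies -/

lemma agreeUpTo_zero (a b : ℝ → ℝ) : AgreeUpTo 0 a b := by
  simp [AgreeUpTo]

lemma exists_limit_control {u : ℕ → ℝ → ℝ} (hu : ∀ n, Measurable (u n)) {τ : ℝ} (hτ : 0 < τ)
    (h : ∀ n : ℕ, AgreeUpTo (n * τ) (u n) (u (n + 1))) :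
    ∃ ψ : ℝ → ℝ, Measurable ψ ∧ (∀ s, ∃ n, ψ s = u n s) ∧
      ∀ n : ℕ, AgreeUpTo (n * τ) ψ (u n) := by
  have hmono : ∀ k n : ℕ, k ≤ n → AgreeUpTo (k * τ) (u k) (u n) := by
    intro k n hkn
    induction n, hkn using Nat.le_induction with
    | base => exact AgreeUpTo.of_eqOn fun _ _ => rfl
    | succ n hn ih =>
      exact ih.trans ((h n).mono (mul_le_mul_of_nonneg_right (by exact_mod_cast hn) hτ.le))
  -- At time `s` the first stage `n` with `s ≤ n * τ` is used. Taking actual values of the `u n`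
  -- keeps the headings in `[-π, π]` everywhere, not just almost everywhere.
  refine ⟨fun s => u ⌈s / τ⌉₊ s, ?_, fun s => ⟨_, rfl⟩, fun n => ?_⟩
  · have hF : Measurable fun q : ℕ × ℝ => u q.1 q.2 :=
      measurable_from_prod_countable_right fun n => hu n
    exact hF.comp ((Nat.measurable_ceil.comp (measurable_id.div_const τ)).prodMk measurable_id)
  · have hall : ∀ᵐ s ∂volume, ∀ k : ℕ, k ≤ n → s ∈ Icc 0 (k * τ) → u k s = u n s := by
      refine ae_all_iff.2 fun k => ?_
      by_cases hk : k ≤ n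
      · filter_upwards [(ae_restrict_iff' measurableSet_Icc).1 (hmono k n hk)] with s hs _ h
          using hs h
      · exact Filter.Eventually.of_forall fun s h => absurd h hk
    refine (ae_restrict_iff' measurableSet_Icc).2 ?_
    filter_upwards [hall] with s hs hmem
    refine hs _ (Nat.ceil_le.2 ((div_le_iff₀ hτ).2 hmem.2)) ⟨hmem.1, ?_⟩
    exact (div_le_iff₀ hτ).1 (Nat.le_ceil _)

lemma admissible_of_limit {xbar v : ℝ} {p : ℝ × ℝ} {u : ℕ → ℝ → ℝ}
    (hu : ∀ n, Admissible xbar v p (u n)) {τ : ℝ} (hτ : 0 < τ) {ψ : ℝ → ℝ} (hψ : Measurable ψ)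
    (hval : ∀ s, ∃ n, ψ s = u n s) (hlim : ∀ n : ℕ, AgreeUpTo (n * τ) ψ (u n)) :
    Admissible xbar v p ψ := by
  refine ⟨hψ, fun s => ?_, fun t ht => ?_⟩
  · obtain ⟨n, hn⟩ := hval s
    rw [hn]
    exact (hu n).2.1 s
  · obtain ⟨n, hn⟩ := exists_nat_ge (t / τ)
    rw [((hlim n).mono ((div_le_iff₀ hτ).1 hn)).pos_eq ht v p]
    exact (hu n).2.2 t ht

/-- Iterating `ψ ↦ β (α ψ)` prolongs agreement of successive stages by the delay `τ` each time. The
limit is a fixed point up to null sets, which suffices for equal positions and hence equal captures.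
-/
lemma exists_play {xbar v : ℝ} {x : State} {α : (ℝ → ℝ) × (ℝ → ℝ) → (ℝ → ℝ)}
    {β : (ℝ → ℝ) → (ℝ → ℝ) × (ℝ → ℝ)} (hα : EvaderStrategy xbar v x α)
    (hβ : TeamStrategy xbar v x β) {ψ₀ : (ℝ → ℝ) × (ℝ → ℝ)} (hψ₀ : TeamAdmissible xbar v x ψ₀) :
    ∃ ψ, TeamAdmissible xbar v x ψ ∧
      ∀ t, 0 ≤ t → (CaptureAt v x (α ψ) (β (α ψ)) t ↔ CaptureAt v x (α ψ) ψ t) := by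
  obtain ⟨hα1, τ, hτ, hα2⟩ := hα
  obtain ⟨hβ1, hβ2⟩ := hβ
  let u : ℕ → (ℝ → ℝ) × (ℝ → ℝ) := fun n => (fun ψ => β (α ψ))^[n] ψ₀
  have hsucc : ∀ n, u (n + 1) = β (α (u n)) := fun n => Function.iterate_succ_apply' _ _ _
  have hu : ∀ n, TeamAdmissible xbar v x (u n) := by
    intro n
    induction n with
    | zero => exact hψ₀
    | succ n ih => rw [hsucc]; exact hβ1 _ (hα1 _ ih)
  have hagree : ∀ n : ℕ, TeamAgreeUpTo (n * τ) (u n) (u (n + 1)) := by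
    intro n
    induction n with
    | zero => simpa using ⟨agreeUpTo_zero _ _, agreeUpTo_zero _ _⟩
    | succ n ih =>
      have h0 : 0 ≤ n * τ := by positivity
      have := hα2 _ _ (hu n) (hu (n + 1)) _ h0 ih
      rw [hsucc (n + 1), hsucc n]
      rw [hsucc n] at this
      refine hβ2 _ _ (hα1 _ (hu n)) (hsucc n ▸ hα1 _ (hu (n + 1))) _ (by positivity) ?_
      rwa [show ((n + 1 : ℕ) : ℝ) * τ = n * τ + τ by push_cast; ring]
  obtain ⟨ψ₁, hm1, hv1, hl1⟩ :=
    exists_limit_control (u := fun n => (u n).1) (fun n => (hu n).1.1) hτ fun n => (hagree n).1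
  obtain ⟨ψ₂, hm2, hv2, hl2⟩ :=
    exists_limit_control (u := fun n => (u n).2) (fun n => (hu n).2.1) hτ fun n => (hagree n).2
  have hψ : TeamAdmissible xbar v x (ψ₁, ψ₂) :=
    ⟨admissible_of_limit (fun n => (hu n).1) hτ hm1 hv1 hl1,
      admissible_of_limit (fun n => (hu n).2) hτ hm2 hv2 hl2⟩
  refine ⟨(ψ₁, ψ₂), hψ, fun t ht => ?_⟩
  obtain ⟨n, hn⟩ := exists_nat_ge (t / τ)
  have hnt : t ≤ n * τ := (div_le_iff₀ hτ).1 hn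
  have h0 : 0 ≤ n * τ := by positivity
  have hA : AgreeUpTo (n * τ) (α (ψ₁, ψ₂)) (α (u n)) :=
    (hα2 _ _ hψ (hu n) _ h0 ⟨hl1 n, hl2 n⟩).mono (by linarith)
  have hfix := hβ2 _ _ (hα1 _ hψ) (hα1 _ (hu n)) _ h0 hA
  rw [← hsucc] at hfix
  have e1 : pos v x.P1 (β (α (ψ₁, ψ₂))).1 t = pos v x.P1 ψ₁ t :=
    ((hfix.1.trans ((hagree n).1.symm.trans (hl1 n).symm)).mono hnt).pos_eq ht v _
  have e2 : pos v x.P2 (β (α (ψ₁, ψ₂))).2 t = pos v x.P2 ψ₂ t :=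
    ((hfix.2.trans ((hagree n).2.symm.trans (hl2 n).symm)).mono hnt).pos_eq ht v _
  simp only [CaptureAt, e1, e2]

end Football

/-! ### The trichotomy -/

theorem theorem1 (xbar v : ℝ) (hv : 0 < v) (x : Football.State)
    (hE : x.E ∈ Football.field xbar)
    (hP1 : x.P1 ∈ Football.field xbar)
    (hP2 : x.P2 ∈ Football.field xbar)
    (hE1 : x.E ≠ x.P1) (hE2 : x.E ≠ x.P2)
    (h12 : x.x1 < x.x2)
    (hI0 : x.xE < x.x2 → 0 ≤ x.xI)
    (hI1 : x.x1 < x.xE → x.xI ≤ xbar) :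
    (x ∈ Football.pursuersWinningSet xbar v ↔ Football.B xbar x < 0) ∧
    (x ∈ Football.evaderWinningSet xbar v ↔ 0 < Football.B xbar x) ∧
    (x ∈ Football.barrier xbar v ↔ Football.B xbar x = 0) := by
  open Football in
  obtain ⟨g, hg, hg1, hg2, -⟩ := exists_optimal_goal_point hv hE h12 hI0 hI1
  have hrun := admissible_runTo hv hE hg
  -- Any admissible pair would do: it only seeds the iteration in `exists_play`.
  have hψ₀ : TeamAdmissible xbar v x (runTo v x.P1 g, runTo v x.P2 g) :=
    ⟨admissible_runTo hv hP1 hg, admissible_runTo hv hP2 hg⟩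
  have hwin : 0 < B xbar x → ∀ ψ, TeamAdmissible xbar v x ψ →
      ReachesFirst xbar v x (runTo v x.E g) ψ := fun hB ψ hψ =>
    runTo_reachesFirst hv hg
      ((sq_lt_sq₀ (goalDist_nonneg _ _) (goalDist_nonneg _ _)).1 (by linarith))
      ((sq_lt_sq₀ (goalDist_nonneg _ _) (goalDist_nonneg _ _)).1 (by linarith)) hψ
  have htie : 0 ≤ B xbar x → ∀ ψ, TeamAdmissible xbar v x ψ →
      ReachesFirstOrTie xbar v x (runTo v x.E g) ψ := fun hB ψ hψ =>
    runTo_reachesFirstOrTie hv hE1 hE2 hg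
      ((sq_le_sq₀ (goalDist_nonneg _ _) (goalDist_nonneg _ _)).1 (by linarith))
      ((sq_le_sq₀ (goalDist_nonneg _ _) (goalDist_nonneg _ _)).1 (by linarith)) hψ
  have hteam := exists_teamStrategy hv hE hP1 hP2 h12 hI0 hI1
  refine ⟨⟨?_, fun hB => ?_⟩, ⟨?_, fun hB => ?_⟩, ⟨?_, fun hB => ?_⟩⟩
  · rintro ⟨β, hβ, h⟩
    by_contra! hB
    exact h _ hrun (htie hB _ (hβ.1 _ hrun))
  · obtain ⟨β, hβ, h⟩ := hteam hB.le
    exact ⟨β, hβ, fun φ hφ => (h φ hφ).2 hB⟩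
  · rintro ⟨α, hα, h⟩
    by_contra! hB
    obtain ⟨β, hβ, hβ'⟩ := hteam hB
    obtain ⟨ψ, hψ, hplay⟩ := exists_play hα hβ hψ₀
    obtain ⟨t, ht, hgoal, hno⟩ := h ψ hψ
    exact (hβ' _ (hα.1 ψ hψ)).1
      ⟨t, ht, hgoal, fun s hs hst hc => hno s hs hst ((hplay s hs).1 hc)⟩
  · exact ⟨_, evaderStrategy_const hrun, hwin hB⟩
  · rintro ⟨⟨β, hβ, hβ'⟩, α, hα, h⟩
    rcases lt_trichotomy (B xbar x) 0 with hB | hB | hB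
    -- The tie-forcing `β` of the hypothesis is replaced by a winning one, which is then played
    -- against `α`.
    · obtain ⟨β, hβ, hβ'⟩ := hteam hB.le
      obtain ⟨ψ, hψ, hplay⟩ := exists_play hα hβ hψ₀
      obtain ⟨t, ht, hgoal, hno⟩ := h ψ hψ
      exact ((hβ' _ (hα.1 ψ hψ)).2 hB
        ⟨t, ht, hgoal, fun s hs hst hc => hno s hs hst ((hplay s hs).1 hc)⟩).elim
    · exact hB
    · exact (hβ' _ hrun (hwin hB _ (hβ.1 _ hrun))).elim
  · obtain ⟨β, hβ, hβ'⟩ := hteam hB.le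
    exact ⟨⟨β, hβ, fun φ hφ => (hβ' φ hφ).1⟩, _, evaderStrategy_const hrun, htie hB.ge⟩
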